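/- Let $X$ be a real normed space of dimension at least $2$, and for $x,y\in X$ let $$\rho_{\pm}(x,y)=\lim_{t\to 0^{\pm}}\frac{\|x+ty\|^2-\|x\|^2}{2t}$$ (these limits always exist). Write $x\perp_{\rho_*}y$ if $\rho_-(x,y)\,\rho_+(x,y)=0$. Let $Y$ be a real Banach space, let $\varepsilon\in\mathbb{R}$, and let $f:X\to Y$ be a mapping such that $$x\perp_{\rho_*}y\ \Longrightarrow\ \|f(x+y)-f(x)-f(y)\|\le\varepsilon\qquad(x,y\in X).$$ Then there exist exactly one additive mapping $A:X\to Y$ (that is, $A(x+y)=A(x)+A(y)$ for all $x,y\in X$) and exactly one quadratic mapping $Q:X\to Y$ (that is, $Q(x+y)+Q(x-y)=2Q(x)+2Q(y)$ for all $x,y\in X$) such that $$\|f(x)-f(0)-A(x)-Q(x)\|\le\frac{68}{3}\,\varepsilon\qquad(x\in X).$$ -/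

import Mathlib

open Filter Topology

noncomputable section

namespace RhoStar

variable {X : Type*} [NormedAddCommGroup X] [NormedSpace ℝ X]

/-- The right norm derivative `ρ₊(x, y) = lim_{t → 0⁺} (‖x + t y‖² - ‖x‖²) / (2t)`. -/
def rhoPlus (x y : X) : ℝ :=
  limUnder (𝓝[>] (0 : ℝ)) (fun t : ℝ => (‖x + t • y‖ ^ 2 - ‖x‖ ^ 2) / (2 * t))

/-- The left norm derivative `ρ₋(x, y) = lim_{t → 0⁻} (‖x + t y‖² - ‖x‖²) / (2t)`. -/
def rhoMinus (x y : X) : ℝ :=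
  limUnder (𝓝[<] (0 : ℝ)) (fun t : ℝ => (‖x + t • y‖ ^ 2 - ‖x‖ ^ 2) / (2 * t))

lemma convexOn_norm_line (x y : X) :
    ConvexOn ℝ Set.univ (fun t : ℝ => ‖x + t • y‖) := by
  refine ⟨convex_univ, fun a _ b _ p q hp hq hpq => ?_⟩
  have h : x + (p • a + q • b) • y = p • (x + a • y) + q • (x + b • y) := by
    have hx : x = (p + q) • x := by rw [hpq, one_smul]
    nth_rewrite 1 [hx]
    simp only [smul_eq_mul]
    module
  calc ‖x + (p • a + q • b) • y‖ = ‖p • (x + a • y) + q • (x + b • y)‖ := by rw [h]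
    _ ≤ ‖p • (x + a • y)‖ + ‖q • (x + b • y)‖ := norm_add_le _ _
    _ = p • ‖x + a • y‖ + q • ‖x + b • y‖ := by
      rw [norm_smul, norm_smul, Real.norm_of_nonneg hp, Real.norm_of_nonneg hq]; rfl

/-- The limit defining `ρ₊` exists. -/
lemma tendsto_rhoPlus (x y : X) :
    Tendsto (fun t : ℝ => (‖x + t • y‖ ^ 2 - ‖x‖ ^ 2) / (2 * t)) (𝓝[>] (0 : ℝ))
      (𝓝 (rhoPlus x y)) := by
  have hd := ((convexOn_norm_line x y).differentiableWithinAt_Ioi_of_mem_interior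
    (x := 0) (by simp)).pow 2 |>.hasDerivWithinAt
  rw [hasDerivWithinAt_iff_tendsto_slope' (by simp)] at hd
  refine tendsto_nhds_limUnder ⟨_, (hd.div_const 2).congr fun t => ?_⟩
  simp only [slope_def_field, Pi.pow_apply, zero_smul, add_zero, sub_zero]
  rw [div_div, mul_comm]

/-- The limit defining `ρ₋` exists. -/
lemma tendsto_rhoMinus (x y : X) :
    Tendsto (fun t : ℝ => (‖x + t • y‖ ^ 2 - ‖x‖ ^ 2) / (2 * t)) (𝓝[<] (0 : ℝ))
      (𝓝 (rhoMinus x y)) := by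
  have hd := ((convexOn_norm_line x y).differentiableWithinAt_Iio_of_mem_interior
    (x := 0) (by simp)).pow 2 |>.hasDerivWithinAt
  rw [hasDerivWithinAt_iff_tendsto_slope' (by simp)] at hd
  refine tendsto_nhds_limUnder ⟨_, (hd.div_const 2).congr fun t => ?_⟩
  simp only [slope_def_field, Pi.pow_apply, zero_smul, add_zero, sub_zero]
  rw [div_div, mul_comm]

/-- `ρ_*(x, y) = ρ₋(x, y) ρ₊(x, y)`. -/
def rhoStar (x y : X) : ℝ := rhoMinus x y * rhoPlus x y

/-- `x` is `ρ_*`-orthogonal to `y`. -/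
def Orth (x y : X) : Prop := rhoStar x y = 0

/-- Additive mappings (no continuity or homogeneity is required). -/
def IsAdditive {E Y : Type*} [AddCommGroup E] [AddCommGroup Y] (A : E → Y) : Prop :=
  ∀ x y : E, A (x + y) = A x + A y

/-- Quadratic mappings: `Q (x + y) + Q (x - y) = 2 Q x + 2 Q y`. -/
def IsQuadratic {E Y : Type*} [AddCommGroup E] [AddCommGroup Y] (Q : E → Y) : Prop :=
  ∀ x y : E, Q (x + y) + Q (x - y) = 2 • Q x + 2 • Q y

end RhoStar

end

/-!
Fix `c > 0`, a nonzero `x` and a nonzero `w` orthogonal to it, and minimise `‖e^(-cr) x + e^r w‖`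
over real `r`. At the minimiser, `ρ₋ ≤ 0 ≤ ρ₊` for a point `x + tw` (with `t > 0`) and the
direction `tw - cx`. Hence either `x + tw` is orthogonal to `cx - tw`, which is the configuration
in Rätz's Thalesian condition and makes the usual arguments for orthogonality spaces available, or
the norm has a corner at `x + tw`. A vector at which there is a corner is orthogonal to two
transversal directions, and this forces `f - f 0` to be nearly additive along its multiples. If
there are corners at `x + tw` and at `x - sw`, then these two vectors combine to give near
additivity along the multiples of `x`.

In both cases the limits of `2⁻ⁿ f_odd(2ⁿ x)` and `4⁻ⁿ f_even(2ⁿ x)` exist and stay near `f_odd`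
and `f_even`. They are exactly orthogonally additive, and the same dichotomy applied to them makes
an odd one additive and an even one quadratic. Uniqueness holds because a bounded mapping that is
additive or quadratic vanishes.
-/

namespace RhoStar

section NormDerivative

variable {X : Type*} [NormedAddCommGroup X] [NormedSpace ℝ X]

/-! ### Norm derivatives -/

lemma hasDerivWithinAt_norm_sq_line (x y : X) :
    HasDerivWithinAt (fun t : ℝ => ‖x + t • y‖ ^ 2) (2 * rhoPlus x y) (Set.Ici 0) 0 := by
  rw [← hasDerivWithinAt_Ioi_iff_Ici, hasDerivWithinAt_iff_tendsto_slope' (by simp)]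
  refine ((tendsto_rhoPlus x y).const_mul 2).congr fun t => ?_
  simp only [slope_def_field, zero_smul, add_zero, sub_zero]
  ring

lemma hasDerivWithinAt_norm_sq_curve {γ : ℝ → X} {v : X} (hγ : HasDerivAt γ v 0) :
    HasDerivWithinAt (fun t => ‖γ t‖ ^ 2) (2 * rhoPlus (γ 0) v) (Set.Ici 0) 0 := by
  have norm_sub_norm : (fun t : ℝ => ‖γ t‖ - ‖γ 0 + t • v‖) =o[𝓝 0] fun t : ℝ => t := by
    have tangent := hγ.isLittleO
    simp only [sub_zero, sub_sub] at tangent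
    exact (Asymptotics.isBigO_of_le _ fun t => abs_norm_sub_norm_le _ _).trans_isLittleO tangent
  have norm_add_norm : (fun t : ℝ => ‖γ t‖ + ‖γ 0 + t • v‖) =O[𝓝 0] fun _ => (1 : ℝ) := by
    have line : Continuous fun t : ℝ => ‖γ 0 + t • v‖ := by fun_prop
    exact (hγ.continuousAt.norm.add line.continuousAt).isBigO_one ℝ
  have sq_sub_sq : HasDerivAt (fun t : ℝ => ‖γ t‖ ^ 2 - ‖γ 0 + t • v‖ ^ 2) 0 0 := by
    refine .of_isLittleO ((norm_sub_norm.mul_isBigO norm_add_norm).congr ?_ ?_)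
    · intro t
      simp only [zero_smul, add_zero, smul_zero]
      ring
    · simp
  refine ((sq_sub_sq.hasDerivWithinAt.add (hasDerivWithinAt_norm_sq_line (γ 0) v)).congr_deriv
    (zero_add _)).congr ?_ ?_ <;> simp

lemma rhoPlus_eq_of_hasDerivWithinAt {γ : ℝ → X} {x v : X} {l : ℝ} (h0 : γ 0 = x)
    (hγ : HasDerivAt γ v 0)
    (hl : HasDerivWithinAt (fun t => ‖γ t‖ ^ 2) (2 * l) (Set.Ici 0) 0) : rhoPlus x v = l := by
  have := (uniqueDiffWithinAt_Ici (0 : ℝ)).eq_deriv _ (hasDerivWithinAt_norm_sq_curve hγ) hl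
  rw [h0] at this
  linarith

lemma hasDerivAt_line (x y : X) : HasDerivAt (fun t : ℝ => x + t • y) y 0 := by
  simpa using ((hasDerivAt_id (0 : ℝ)).smul_const y).const_add x

lemma rhoPlus_neg_right (x y : X) : rhoPlus x (-y) = -rhoMinus x y := by
  have reflected := ((tendsto_rhoMinus x y).comp
    (by simpa using tendsto_neg_nhdsGT (a := (0 : ℝ)))).neg
  refine tendsto_nhds_unique (tendsto_rhoPlus x (-y)) (reflected.congr fun t => ?_)
  simp only [Function.comp_apply, neg_smul, smul_neg, mul_neg, div_neg, neg_neg]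

lemma rhoMinus_eq_neg_rhoPlus_neg (x y : X) : rhoMinus x y = -rhoPlus x (-y) := by
  rw [rhoPlus_neg_right, neg_neg]

lemma rhoPlus_smul_smul (c : ℝ) (x y : X) : rhoPlus (c • x) (c • y) = c ^ 2 * rhoPlus x y := by
  refine tendsto_nhds_unique (tendsto_rhoPlus _ _)
    (((tendsto_rhoPlus x y).const_mul (c ^ 2)).congr fun t => ?_)
  rw [smul_comm t c y, ← smul_add, norm_smul, norm_smul, mul_pow, mul_pow, Real.norm_eq_abs,
    sq_abs]
  ring

lemma rhoPlus_smul_right (x y : X) {c : ℝ} (hc : 0 ≤ c) :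
    rhoPlus x (c • y) = c * rhoPlus x y := by
  refine rhoPlus_eq_of_hasDerivWithinAt (by simp) (hasDerivAt_line x (c • y)) ?_
  have rescale : HasDerivWithinAt (fun t : ℝ => t * c) c (Set.Ici 0) 0 :=
    (hasDerivAt_mul_const c).hasDerivWithinAt
  refine ((HasDerivWithinAt.comp_of_eq 0 (hasDerivWithinAt_norm_sq_line x y) rescale
    (fun t ht => mul_nonneg ht hc) (zero_mul c).symm).congr_deriv (by ring)).congr ?_ ?_ <;>
  simp [mul_smul]

lemma rhoPlus_smul_self_add (x y : X) (s : ℝ) :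
    rhoPlus x (s • x + y) = s * ‖x‖ ^ 2 + rhoPlus x y := by
  have factor : HasDerivAt (fun t : ℝ => 1 + t * s) s 0 := (hasDerivAt_mul_const s).const_add 1
  have curve : HasDerivAt (fun t : ℝ => (1 + t * s) • (x + t • y)) (s • x + y) 0 := by
    refine (factor.smul (hasDerivAt_line x y)).congr_deriv ?_
    simp [add_comm]
  refine rhoPlus_eq_of_hasDerivWithinAt (by simp) curve ?_
  refine (((factor.hasDerivWithinAt.pow 2).mul (hasDerivWithinAt_norm_sq_line x y)).congr_deriv
    ?_).congr ?_ ?_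
  · simp only [Nat.cast_ofNat, zero_mul, add_zero, Nat.add_one_sub_one, one_pow, mul_one,
      zero_smul, Pi.pow_apply, one_mul]
    ring
  · intro t _
    rw [norm_smul, mul_pow, Real.norm_eq_abs, sq_abs]
    rfl
  · simp

lemma rhoMinus_smul_smul (c : ℝ) (x y : X) :
    rhoMinus (c • x) (c • y) = c ^ 2 * rhoMinus x y := by
  rw [rhoMinus_eq_neg_rhoPlus_neg, ← smul_neg, rhoPlus_smul_smul, rhoPlus_neg_right]
  ring

lemma rhoMinus_smul_right (x y : X) {c : ℝ} (hc : 0 ≤ c) :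
    rhoMinus x (c • y) = c * rhoMinus x y := by
  rw [rhoMinus_eq_neg_rhoPlus_neg, ← smul_neg, rhoPlus_smul_right _ _ hc, rhoPlus_neg_right]
  ring

lemma rhoMinus_smul_self_add (x y : X) (s : ℝ) :
    rhoMinus x (s • x + y) = s * ‖x‖ ^ 2 + rhoMinus x y := by
  rw [rhoMinus_eq_neg_rhoPlus_neg, neg_add, ← neg_smul, rhoPlus_smul_self_add,
    rhoPlus_neg_right]
  ring

lemma rhoPlus_zero_left (y : X) : rhoPlus 0 y = 0 := by
  have quadratic := rhoPlus_smul_smul 2 0 y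
  rw [smul_zero, rhoPlus_smul_right 0 y zero_le_two] at quadratic
  linarith

lemma rhoMinus_zero_left (y : X) : rhoMinus 0 y = 0 := by
  rw [rhoMinus_eq_neg_rhoPlus_neg, rhoPlus_zero_left, neg_zero]

lemma rhoPlus_nonneg_of_norm_le {γ : ℝ → X} {v : X} (hγ : HasDerivAt γ v 0)
    (hmin : ∀ t, ‖γ 0‖ ≤ ‖γ t‖) : 0 ≤ rhoPlus (γ 0) v := by
  have deriv := (hasDerivWithinAt_norm_sq_curve hγ).Ioi_of_Ici
  rw [hasDerivWithinAt_iff_tendsto_slope' (by simp)] at deriv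
  have : 0 ≤ 2 * rhoPlus (γ 0) v := by
    refine ge_of_tendsto deriv (eventually_mem_nhdsWithin.mono fun t (ht : 0 < t) => ?_)
    rw [slope_def_field, sub_zero]
    exact div_nonneg (sub_nonneg.2 (pow_le_pow_left₀ (norm_nonneg _) (hmin t) 2)) ht.le
  linarith

lemma rhoMinus_nonpos_of_norm_le {γ : ℝ → X} {v : X} (hγ : HasDerivAt γ v 0)
    (hmin : ∀ t, ‖γ 0‖ ≤ ‖γ t‖) : rhoMinus (γ 0) v ≤ 0 := by
  have reversed : HasDerivAt (fun t => γ (-t)) (-v) 0 := by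
    simpa using (HasDerivAt.comp_const_sub 0 0 (f := γ) (f' := v) (by simpa using hγ))
  have := rhoPlus_nonneg_of_norm_le reversed fun t => by simpa using hmin (-t)
  rw [neg_zero, rhoPlus_neg_right] at this
  linarith

/-! ### `ρ_*`-orthogonality -/

lemma orth_iff {x y : X} : Orth x y ↔ rhoMinus x y = 0 ∨ rhoPlus x y = 0 := mul_eq_zero

lemma orth_zero_left (y : X) : Orth 0 y := orth_iff.2 (.inr (rhoPlus_zero_left y))

lemma Orth.neg_right {x y : X} (h : Orth x y) : Orth x (-y) := by
  rw [orth_iff, rhoPlus_neg_right, rhoMinus_eq_neg_rhoPlus_neg, neg_neg, neg_eq_zero, neg_eq_zero]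
  exact (orth_iff.1 h).symm

lemma Orth.smul_right {x y : X} (h : Orth x y) (c : ℝ) : Orth x (c • y) := by
  have smul_of_nonneg {c : ℝ} (hc : 0 ≤ c) : Orth x (c • y) := by
    rw [orth_iff, rhoPlus_smul_right _ _ hc, rhoMinus_smul_right _ _ hc]
    exact (orth_iff.1 h).imp (mul_eq_zero_of_right c) (mul_eq_zero_of_right c)
  rcases le_total 0 c with hc | hc
  · exact smul_of_nonneg hc
  · simpa using (smul_of_nonneg (neg_nonneg.2 hc)).neg_right

lemma Orth.smul_left {x y : X} (h : Orth x y) (c : ℝ) : Orth (c • x) y := by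
  rcases eq_or_ne c 0 with rfl | hc
  · simpa using orth_zero_left y
  have := orth_iff.1 (h.smul_right c⁻¹)
  rw [← smul_inv_smul₀ hc y, orth_iff, rhoPlus_smul_smul, rhoMinus_smul_smul]
  exact this.imp (mul_eq_zero_of_right _) (mul_eq_zero_of_right _)

lemma Orth.smul {x y : X} (h : Orth x y) (a b : ℝ) : Orth (a • x) (b • y) :=
  (h.smul_left a).smul_right b

lemma orth_sub_rhoPlus_div_smul (x v : X) : Orth x (v - (rhoPlus x v / ‖x‖ ^ 2) • x) := by
  rcases eq_or_ne x 0 with rfl | hx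
  · exact orth_zero_left _
  refine orth_iff.2 (.inr ?_)
  rw [sub_eq_neg_add, ← neg_smul, rhoPlus_smul_self_add]
  field_simp
  ring

lemma orth_sub_rhoMinus_div_smul (x v : X) : Orth x (v - (rhoMinus x v / ‖x‖ ^ 2) • x) := by
  rcases eq_or_ne x 0 with rfl | hx
  · exact orth_zero_left _
  refine orth_iff.2 (.inl ?_)
  rw [sub_eq_neg_add, ← neg_smul, rhoMinus_smul_self_add]
  field_simp
  ring

lemma exists_eq_smul_add_orth (x v : X) : ∃ (β : ℝ) (w : X), Orth x w ∧ v = β • x + w :=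
  ⟨rhoPlus x v / ‖x‖ ^ 2, _, orth_sub_rhoPlus_div_smul x v, by abel⟩

lemma exists_ne_zero_orth (hX : 2 ≤ Module.rank ℝ X) (x : X) : ∃ w : X, w ≠ 0 ∧ Orth x w := by
  by_contra! h
  have rank_le : Module.rank ℝ X ≤ 1 := rank_le_one_iff.2 ⟨x, fun v => by
    obtain ⟨β, w, hxw, rfl⟩ := exists_eq_smul_add_orth x v
    have hw : w = 0 := by_contra fun hw => h w hw hxw
    exact ⟨β, by rw [hw, add_zero]⟩⟩
  exact absurd (hX.trans rank_le) (by norm_num)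

/-! ### Corners and Thales pairs -/

/-- The norm has a corner at `z` in the direction `v`: its two one-sided derivatives there
differ. Corners are the only obstruction to the existence of Thales pairs. -/
def Corner (z v : X) : Prop := rhoMinus z v ≠ rhoPlus z v

lemma Corner.of_smul_self_add_smul {z v : X} {a b : ℝ} (h : Corner z (a • z + b • v)) :
    Corner z v := by
  intro heq
  apply h
  rcases le_total 0 b with hb | hb
  · rw [rhoMinus_smul_self_add, rhoPlus_smul_self_add, rhoMinus_smul_right _ _ hb,
      rhoPlus_smul_right _ _ hb, heq]
  · rw [← neg_neg b, neg_smul, ← smul_neg, rhoMinus_smul_self_add, rhoPlus_smul_self_add,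
      rhoMinus_smul_right _ _ (neg_nonneg.2 hb), rhoPlus_smul_right _ _ (neg_nonneg.2 hb),
      rhoPlus_neg_right, rhoMinus_eq_neg_rhoPlus_neg, neg_neg, heq]

lemma Corner.exists_orth {z v : X} (h : Corner z v) :
    ∃ (u : X) (d p : ℝ), d ≠ 0 ∧ Orth z u ∧ Orth z (u - d • z) ∧ v = p • z + u := by
  have hz : z ≠ 0 := by
    rintro rfl
    exact h (by rw [rhoMinus_zero_left, rhoPlus_zero_left])
  refine ⟨v - (rhoMinus z v / ‖z‖ ^ 2) • z, rhoPlus z v / ‖z‖ ^ 2 - rhoMinus z v / ‖z‖ ^ 2,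
    rhoMinus z v / ‖z‖ ^ 2, ?_, orth_sub_rhoMinus_div_smul z v, ?_, by abel⟩
  · rw [← sub_div]
    exact div_ne_zero (sub_ne_zero.2 h.symm) (by positivity)
  · convert orth_sub_rhoPlus_div_smul z v using 1
    module

/-- The configuration in Rätz's Thalesian condition for orthogonality spaces: the triangle with
vertices `-x`, `c • x` and `y` has a right angle at `y`, and `0` is the foot of its altitude
from `y`. -/
def Thales (c : ℝ) (x y : X) : Prop := Orth x y ∧ Orth (x + y) (c • x - y)

lemma Thales.smul {c : ℝ} {x y : X} (h : Thales c x y) (a : ℝ) : Thales c (a • x) (a • y) := by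
  refine ⟨h.1.smul a a, ?_⟩
  rw [smul_comm c a x, ← smul_add, ← smul_sub]
  exact h.2.smul a a

lemma tendsto_norm_smul_add_atTop {α : Type*} {l : Filter α} {a : α → ℝ} {g : α → X} {x y : X}
    (hx : x ≠ 0) (ha : Tendsto a l atTop) (hg : Tendsto g l (𝓝 y)) :
    Tendsto (fun r => ‖a r • x + g r‖) l atTop := by
  have large : Tendsto (fun r => a r * ‖x‖ + -‖g r‖) l atTop :=
    (ha.atTop_mul_const (norm_pos_iff.2 hx)).atTop_add hg.norm.neg
  refine tendsto_atTop_mono (fun r => ?_) large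
  calc a r * ‖x‖ + -‖g r‖ ≤ ‖a r • x‖ - ‖-g r‖ := by
        rw [norm_smul, norm_neg, ← sub_eq_add_neg]
        gcongr
        exact Real.le_norm_self _
    _ ≤ ‖a r • x + g r‖ := by simpa using norm_sub_norm_le (a r • x) (-g r)

lemma exists_norm_exp_smul_add_exp_smul_le {x w : X} (hx : x ≠ 0) (hw : w ≠ 0) {c : ℝ}
    (hc : 0 < c) : ∃ s : ℝ, ∀ r : ℝ,
      ‖Real.exp (-c * s) • x + Real.exp s • w‖ ≤ ‖Real.exp (-c * r) • x + Real.exp r • w‖ := by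
  have cont : Continuous fun r : ℝ => ‖Real.exp (-c * r) • x + Real.exp r • w‖ := by fun_prop
  refine cont.exists_forall_le ?_
  rw [cocompact_eq_atBot_atTop]
  refine Tendsto.sup ?_ ?_
  · exact tendsto_norm_smul_add_atTop hx
      (Real.tendsto_exp_atTop.comp (tendsto_id.const_mul_atBot_of_neg (neg_lt_zero.2 hc)))
      (Real.tendsto_exp_atBot.smul_const w)
  · simp only [add_comm (Real.exp (-c * _) • x)]
    exact tendsto_norm_smul_add_atTop hw Real.tendsto_exp_atTop
      ((Real.tendsto_exp_atBot.comp
        (tendsto_id.const_mul_atTop_of_neg (neg_lt_zero.2 hc))).smul_const x)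

lemma exists_rhoMinus_nonpos_rhoPlus_nonneg {x w : X} (hx : x ≠ 0) (hw : w ≠ 0) {c : ℝ}
    (hc : 0 < c) : ∃ t : ℝ, 0 < t ∧
      rhoMinus (x + t • w) (t • w - c • x) ≤ 0 ∧ 0 ≤ rhoPlus (x + t • w) (t • w - c • x) := by
  obtain ⟨s, hs⟩ := exists_norm_exp_smul_add_exp_smul_le hx hw hc
  set γ : ℝ → X := fun r => Real.exp (-c * (s + r)) • x + Real.exp (s + r) • w with hγdef
  set a := Real.exp (-c * s)
  have ha : 0 < a := Real.exp_pos _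
  set t := Real.exp s / a
  have hb : Real.exp s = a * t := (mul_div_cancel₀ _ ha.ne').symm
  have γ_zero : γ 0 = a • (x + t • w) := by
    simp only [hγdef, add_zero, smul_add, smul_smul, ← hb]
    rfl
  have shift : HasDerivAt (fun r : ℝ => s + r) 1 0 := (hasDerivAt_id 0).const_add s
  have hγ : HasDerivAt γ (a • (t • w - c • x)) 0 := by
    refine (((shift.const_mul (-c)).exp.smul_const x).add (shift.exp.smul_const w)).congr_deriv ?_
    simp only [add_zero, mul_one, hb]
    module
  have hmin (r : ℝ) : ‖γ 0‖ ≤ ‖γ r‖ := by simpa only [hγdef, add_zero] using hs (s + r)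
  have h₁ := rhoMinus_nonpos_of_norm_le hγ hmin
  have h₂ := rhoPlus_nonneg_of_norm_le hγ hmin
  rw [γ_zero, rhoMinus_smul_smul] at h₁
  rw [γ_zero, rhoPlus_smul_smul] at h₂
  have ha2 : 0 < a ^ 2 := by positivity
  exact ⟨t, div_pos (Real.exp_pos s) ha, nonpos_of_mul_nonpos_right h₁ ha2,
    nonneg_of_mul_nonneg_right h₂ ha2⟩

lemma exists_orth_or_corner {x w : X} (hx : x ≠ 0) (hw : w ≠ 0) {c : ℝ} (hc : 0 < c) :
    ∃ t : ℝ, 0 < t ∧ (Orth (x + t • w) (c • x - t • w) ∨ Corner (x + t • w) w) := by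
  obtain ⟨t, ht, hminus, hplus⟩ := exists_rhoMinus_nonpos_rhoPlus_nonneg hx hw hc
  refine ⟨t, ht, or_iff_not_imp_right.2 fun hcorner => ?_⟩
  have smooth : rhoMinus (x + t • w) (t • w - c • x) = rhoPlus (x + t • w) (t • w - c • x) := by
    by_contra hne
    rw [show t • w - c • x = (-c) • (x + t • w) + ((1 + c) * t) • w by module] at hne
    exact hcorner (Corner.of_smul_self_add_smul hne)
  rw [← neg_sub]
  exact (orth_iff.2 (.inr (le_antisymm (smooth ▸ hminus) hplus))).neg_right

lemma exists_thales_or_corners {x w : X} (hx : x ≠ 0) (hw : w ≠ 0) (hxw : Orth x w) {c : ℝ}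
    (hc : 0 < c) :
    (∃ y, Thales c x y) ∨
      ∃ s t : ℝ, s ≠ t ∧ Corner (x + s • w) w ∧ Corner (x + t • w) w := by
  obtain ⟨t, ht, h | h⟩ := exists_orth_or_corner hx hw hc
  · exact .inl ⟨t • w, hxw.smul_right t, h⟩
  obtain ⟨s, hs, h' | h'⟩ := exists_orth_or_corner hx (neg_ne_zero.2 hw) hc
  · exact .inl ⟨s • -w, hxw.neg_right.smul_right s, h'⟩
  · rw [smul_neg, ← neg_smul] at h'
    refine .inr ⟨-s, t, (by linarith : -s < t).ne, ?_, h⟩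
    exact Corner.of_smul_self_add_smul (a := 0) (b := -1) (by simpa using h')

end NormDerivative

section Parts

variable {X Y : Type*} [AddCommGroup X]

/-! ### Odd and even parts, additive and quadratic mappings -/

section AddCommGroup

variable [AddCommGroup Y] {A A' Q Q' : X → Y}

lemma IsAdditive.map_zero (hA : IsAdditive A) : A 0 = 0 := by
  simpa using hA 0 0

lemma IsAdditive.map_neg (hA : IsAdditive A) (x : X) : A (-x) = -A x := by
  rw [eq_neg_iff_add_eq_zero, ← hA, neg_add_cancel, hA.map_zero]

lemma IsAdditive.sub (hA : IsAdditive A) (hA' : IsAdditive A') : IsAdditive (A - A') :=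
  fun x y => by
    simp only [Pi.sub_apply, hA x y, hA' x y]
    abel

lemma IsQuadratic.sub (hQ : IsQuadratic Q) (hQ' : IsQuadratic Q') : IsQuadratic (Q - Q') :=
  fun x y => by
    have h := congrArg₂ (· - ·) (hQ x y) (hQ' x y)
    simp only [Pi.sub_apply, smul_sub] at h ⊢
    rw [sub_add_sub_comm, h, add_sub_add_comm]

/-- The Cauchy difference of `f - f 0`. The constant `f 0` makes it vanish whenever one of its
arguments is zero. -/
def cauchyDiff (f : X → Y) (x y : X) : Y := f (x + y) - f x - f y + f 0

lemma cauchyDiff_add_right (f : X → Y) (x y z : X) :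
    cauchyDiff f x (y + z) = cauchyDiff f (x + y) z + cauchyDiff f x y - cauchyDiff f y z := by
  simp only [cauchyDiff, add_assoc]
  abel

variable [Module ℝ Y]

lemma IsQuadratic.map_zero (hQ : IsQuadratic Q) : Q 0 = 0 := by
  have h := hQ 0 0
  rw [add_zero, sub_zero, ← two_smul ℕ, left_eq_add, ← Nat.cast_smul_eq_nsmul ℝ] at h
  exact (smul_eq_zero.1 h).resolve_left (by norm_num)

lemma IsQuadratic.map_neg (hQ : IsQuadratic Q) (x : X) : Q (-x) = Q x := by
  have h := hQ 0 x
  rw [zero_add, zero_sub, hQ.map_zero, smul_zero, zero_add, two_smul] at h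
  exact add_left_cancel h

lemma IsQuadratic.map_add_self (hQ : IsQuadratic Q) (x : X) : Q (x + x) = (4 : ℝ) • Q x := by
  have h := hQ x x
  rw [sub_self, hQ.map_zero, add_zero] at h
  rw [h]
  module

/-- The odd part of a mapping. The stability argument approximates it by an additive mapping. -/
noncomputable def oddPart (f : X → Y) (x : X) : Y := (2⁻¹ : ℝ) • (f x - f (-x))

/-- The even part of a mapping. The stability argument approximates it by a quadratic mapping. -/
noncomputable def evenPart (f : X → Y) (x : X) : Y := (2⁻¹ : ℝ) • (f x + f (-x))

lemma oddPart_neg (f : X → Y) (x : X) : oddPart f (-x) = -oddPart f x := by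
  rw [oddPart, oddPart, neg_neg, ← smul_neg, neg_sub]

lemma evenPart_neg (f : X → Y) (x : X) : evenPart f (-x) = evenPart f x := by
  rw [evenPart, evenPart, neg_neg, add_comm]

lemma oddPart_add_evenPart (f : X → Y) (x : X) : oddPart f x + evenPart f x = f x := by
  rw [oddPart, evenPart]
  module

lemma oddPart_add_eq (hA : IsAdditive A) (hQ : IsQuadratic Q) : oddPart (A + Q) = A := by
  ext x
  simp only [oddPart, Pi.add_apply, hA.map_neg, hQ.map_neg]
  module

lemma evenPart_add_eq (hA : IsAdditive A) (hQ : IsQuadratic Q) : evenPart (A + Q) = Q := by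
  ext x
  simp only [evenPart, Pi.add_apply, hA.map_neg, hQ.map_neg]
  module

end AddCommGroup

variable [NormedAddCommGroup Y] [NormedSpace ℝ Y]

lemma norm_inv_two_smul_add_le {u v : Y} {C : ℝ} (hu : ‖u‖ ≤ C) (hv : ‖v‖ ≤ C) :
    ‖(2⁻¹ : ℝ) • (u + v)‖ ≤ C := by
  rw [norm_smul, Real.norm_of_nonneg (by norm_num)]
  linarith [norm_add_le_of_le hu hv]

lemma norm_inv_two_smul_sub_le {u v : Y} {C : ℝ} (hu : ‖u‖ ≤ C) (hv : ‖v‖ ≤ C) :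
    ‖(2⁻¹ : ℝ) • (u - v)‖ ≤ C := by
  rw [sub_eq_add_neg]
  exact norm_inv_two_smul_add_le hu ((norm_neg v).trans_le hv)

lemma eq_zero_of_map_add_self {F : X → Y} {k C : ℝ} (hk : 1 < k)
    (h : ∀ x, F (x + x) = k • F x) (hF : ∀ x, ‖F x‖ ≤ C) : F = 0 := by
  have scaled (n : ℕ) : ∀ x, k ^ n * ‖F x‖ ≤ C := by
    induction n with
    | zero => simpa using hF
    | succ n ih =>
      intro x
      have := ih (x + x)
      rwa [h, norm_smul, Real.norm_of_nonneg (by linarith), ← mul_assoc, ← pow_succ] at this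
  ext x
  by_contra hx
  obtain ⟨n, hn⟩ := pow_unbounded_of_one_lt (C / ‖F x‖) hk
  rw [div_lt_iff₀ (norm_pos_iff.2 hx)] at hn
  exact (scaled n x).not_gt hn

lemma eq_zero_of_norm_add_le {A Q : X → Y} {C : ℝ} (hA : IsAdditive A) (hQ : IsQuadratic Q)
    (h : ∀ x, ‖(A + Q) x‖ ≤ C) : A = 0 ∧ Q = 0 := by
  constructor
  · refine eq_zero_of_map_add_self (C := C) one_lt_two (fun x => (hA x x).trans (two_smul ℝ _).symm)
      fun x => ?_
    rw [← oddPart_add_eq hA hQ]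
    exact norm_inv_two_smul_sub_le (h x) (h (-x))
  · refine eq_zero_of_map_add_self (k := 4) (C := C) (by norm_num) hQ.map_add_self fun x => ?_
    rw [← evenPart_add_eq hA hQ]
    exact norm_inv_two_smul_add_le (h x) (h (-x))

lemma additive_quadratic_unique {g A A' Q Q' : X → Y} {C C' : ℝ} (hA : IsAdditive A)
    (hA' : IsAdditive A') (hQ : IsQuadratic Q) (hQ' : IsQuadratic Q')
    (h : ∀ x, ‖g x - A x - Q x‖ ≤ C) (h' : ∀ x, ‖g x - A' x - Q' x‖ ≤ C') :
    A = A' ∧ Q = Q' := by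
  have close (x : X) : ‖((A - A') + (Q - Q')) x‖ ≤ C' + C := by
    refine (congrArg norm ?_).trans_le (norm_sub_le_of_le (h' x) (h x))
    simp only [Pi.add_apply, Pi.sub_apply]
    abel
  exact (eq_zero_of_norm_add_le (hA.sub hA') (hQ.sub hQ') close).imp sub_eq_zero.1 sub_eq_zero.1

lemma norm_map_zero_sub_evenPart_le {f : X → Y} {x : X} {C : ℝ}
    (h : ‖cauchyDiff f x (-x)‖ ≤ C) :
    ‖f 0 - evenPart f x‖ ≤ C / 2 := by
  rw [show f 0 - evenPart f x = (2⁻¹ : ℝ) • cauchyDiff f x (-x) by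
    rw [evenPart, cauchyDiff, add_neg_cancel]
    module, norm_smul, Real.norm_of_nonneg (by norm_num)]
  linarith

end Parts

section OrthogonalAdditivity

variable {X Y : Type*} [NormedAddCommGroup X] [NormedSpace ℝ X] [NormedAddCommGroup Y]
  {f F : X → Y} {ε : ℝ}

/-! ### Approximate orthogonal additivity -/

/-- `f` is orthogonally additive up to an error of norm at most `ε`. -/
def NearOrthAdditive (ε : ℝ) (f : X → Y) : Prop :=
  ∀ x y : X, Orth x y → ‖f (x + y) - f x - f y‖ ≤ ε

lemma NearOrthAdditive.norm_map_zero_le (hf : NearOrthAdditive ε f) : ‖f 0‖ ≤ ε := by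
  simpa using hf 0 0 (orth_zero_left 0)

lemma NearOrthAdditive.nonneg (hf : NearOrthAdditive ε f) : 0 ≤ ε :=
  (norm_nonneg _).trans hf.norm_map_zero_le

lemma NearOrthAdditive.norm_cauchyDiff_smul_smul_le (hf : NearOrthAdditive ε f) {z u : X}
    {d : ℝ} (hd : d ≠ 0) (hu : Orth z u) (hu' : Orth z (u - d • z)) (s r : ℝ) :
    ‖cauchyDiff f (s • z) (r • z)‖ ≤ 4 * ε := by
  set p := (-r / d) • u
  set q := (-r / d) • (u - d • z)
  have hq : q = p + r • z := by
    simp only [p, q, smul_sub, smul_smul, div_mul_cancel₀ _ hd]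
    module
  -- The increment of `f` along `r • z` does not depend on the base point `a • z`.
  have increment (a : ℝ) : ‖f (a • z + r • z) - f (a • z) - (f q - f p)‖ ≤ ε + ε := by
    have at_q := hf _ _ (hu'.smul a (-r / d))
    have at_p := hf _ _ (hu.smul (a + r) (-r / d))
    rw [show a • z + (-r / d) • (u - d • z) = (a + r) • z + p by
      change a • z + q = _; rw [hq]; module] at at_q
    refine (congrArg norm ?_).trans_le (norm_sub_le_of_le at_q at_p)
    rw [add_smul]
    abel
  have increment_zero := increment 0
  rw [zero_smul, zero_add] at increment_zero
  calc ‖cauchyDiff f (s • z) (r • z)‖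
      = ‖(f (s • z + r • z) - f (s • z) - (f q - f p)) - (f (r • z) - f 0 - (f q - f p))‖ := by
        rw [cauchyDiff]
        congr 1
        abel
    _ ≤ (ε + ε) + (ε + ε) := norm_sub_le_of_le (increment s) increment_zero
    _ = 4 * ε := by ring

lemma NearOrthAdditive.norm_cauchyDiff_le_of_corner (hf : NearOrthAdditive ε f) {z v p : X}
    (h : Corner z v) (hp : p ∈ Submodule.span ℝ {z, v}) (s : ℝ) :
    ‖cauchyDiff f p (s • z)‖ ≤ 6 * ε := by
  obtain ⟨u, d, r, hd, hu, hu', rfl⟩ := h.exists_orth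
  obtain ⟨a, b, rfl⟩ := Submodule.mem_span_pair.1 hp
  set c := a + b * r
  have split_translate := hf _ _ (hu.smul (c + s) b)
  have split := hf _ _ (hu.smul c b)
  have line := hf.norm_cauchyDiff_smul_smul_le hd hu hu' c s
  rw [show a • z + b • (r • z + u) = c • z + b • u by module]
  calc ‖cauchyDiff f (c • z + b • u) (s • z)‖
      = ‖(f ((c + s) • z + b • u) - f ((c + s) • z) - f (b • u))
          - (f (c • z + b • u) - f (c • z) - f (b • u)) + cauchyDiff f (c • z) (s • z)‖ := by
        rw [cauchyDiff, cauchyDiff, add_right_comm, ← add_smul]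
        congr 1
        abel
    _ ≤ ε + ε + 4 * ε := norm_add_le_of_le (norm_sub_le_of_le split_translate split) line
    _ = 6 * ε := by ring

lemma NearOrthAdditive.norm_cauchyDiff_le_of_corners (hf : NearOrthAdditive ε f) {x w : X}
    {s t : ℝ} (hst : s ≠ t) (hs : Corner (x + s • w) w) (ht : Corner (x + t • w) w) (a b : ℝ) :
    ‖cauchyDiff f (a • x) (b • x)‖ ≤ 18 * ε := by
  have mem_span (r : ℝ) {p : X} (c e : ℝ) (hp : p = c • x + e • w) :
      p ∈ Submodule.span ℝ {x + r • w, w} :=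
    Submodule.mem_span_pair.2 ⟨c, e - c * r, by rw [hp]; module⟩
  obtain ⟨α, β, hαβ, hw⟩ : ∃ α β : ℝ, α + β = b ∧ α * s + β * t = 0 := by
    have : t - s ≠ 0 := sub_ne_zero.2 hst.symm
    exact ⟨b * t / (t - s), -(b * s) / (t - s), by field_simp; ring, by field_simp; ring⟩
  have hbx : b • x = α • (x + s • w) + β • (x + t • w) := by
    rw [← hαβ, show α • (x + s • w) + β • (x + t • w)
      = (α + β) • x + (α * s + β * t) • w by module, hw, zero_smul, add_zero]
  have first := hf.norm_cauchyDiff_le_of_corner hs (mem_span s (p := a • x) a 0 (by module)) α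
  have second := hf.norm_cauchyDiff_le_of_corner ht
    (mem_span t (p := a • x + α • (x + s • w)) (a + α) (α * s) (by module)) β
  have cross := hf.norm_cauchyDiff_le_of_corner ht
    (mem_span t (p := α • (x + s • w)) α (α * s) (by module)) β
  rw [hbx, cauchyDiff_add_right]
  linarith [norm_sub_le_of_le (norm_add_le_of_le second first) cross]

lemma NearOrthAdditive.exists_thales_or_norm_cauchyDiff_le (hX : 2 ≤ Module.rank ℝ X)
    (hf : NearOrthAdditive ε f) (x : X) {c : ℝ} (hc : 0 < c) :
    (∃ y, Thales c x y) ∨ ∀ a b : ℝ, ‖cauchyDiff f (a • x) (b • x)‖ ≤ 18 * ε := by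
  rcases eq_or_ne x 0 with rfl | hx
  · exact .inl ⟨0, orth_zero_left 0, by simpa using orth_zero_left (0 : X)⟩
  obtain ⟨w, hw, hxw⟩ := exists_ne_zero_orth hX x
  exact (exists_thales_or_corners hx hw hxw hc).imp_right fun ⟨_, _, hst, hs, ht⟩ =>
    hf.norm_cauchyDiff_le_of_corners hst hs ht

lemma NearOrthAdditive.norm_map_two_smul_sub_le [NormedSpace ℝ Y] (hf : NearOrthAdditive ε f)
    {x y : X} (h : Thales 1 x y) :
    ‖f ((2 : ℝ) • x) - (2 : ℝ) • f x - f y - f (-y)‖ ≤ 3 * ε := by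
  have diagonals := hf _ _ h.2
  have sum := hf _ _ h.1
  have difference := hf _ _ h.1.neg_right
  rw [one_smul, show x + y + (x - y) = (2 : ℝ) • x by module] at diagonals
  rw [← sub_eq_add_neg] at difference
  calc ‖f ((2 : ℝ) • x) - (2 : ℝ) • f x - f y - f (-y)‖
      = ‖(f ((2 : ℝ) • x) - f (x + y) - f (x - y)) + (f (x + y) - f x - f y)
          + (f (x - y) - f x - f (-y))‖ := by
        congr 1
        module
    _ ≤ ε + ε + ε := norm_add_le_of_le (norm_add_le_of_le diagonals sum) difference
    _ = 3 * ε := by ring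

lemma NearOrthAdditive.norm_map_two_smul_sub_map_two_smul_le_of_even [NormedSpace ℝ Y]
    (hf : NearOrthAdditive ε f) (heven : ∀ x, f (-x) = f x) {x y : X} (h : Thales 1 x y) :
    ‖f ((2 : ℝ) • x) - f ((2 : ℝ) • y)‖ ≤ 6 * ε := by
  have double_x := hf.norm_map_two_smul_sub_le h
  have diagonals := hf _ _ h.2.neg_right
  have sum := hf _ _ h.1
  have difference := hf _ _ h.1.neg_right
  rw [one_smul, show x + y + -(x - y) = (2 : ℝ) • y by module, heven] at diagonals
  rw [← sub_eq_add_neg] at difference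
  calc ‖f ((2 : ℝ) • x) - f ((2 : ℝ) • y)‖
      = ‖(f ((2 : ℝ) • x) - (2 : ℝ) • f x - f y - f (-y))
          - ((f ((2 : ℝ) • y) - f (x + y) - f (x - y)) + (f (x + y) - f x - f y)
            + (f (x - y) - f x - f (-y)))‖ := by
        congr 1
        module
    _ ≤ 3 * ε + (ε + ε + ε) := norm_sub_le_of_le double_x
        (norm_add_le_of_le (norm_add_le_of_le diagonals sum) difference)
    _ = 6 * ε := by ring

lemma NearOrthAdditive.norm_map_two_smul_sub_four_smul_le_of_even [NormedSpace ℝ Y]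
    (hf : NearOrthAdditive ε f) (heven : ∀ x, f (-x) = f x) {x y : X} (h : Thales 1 x y) :
    ‖f ((2 : ℝ) • x) - (4 : ℝ) • f x‖ ≤ 15 * ε := by
  have double_x := hf.norm_map_two_smul_sub_le h
  have map_x_near_map_y := hf.norm_map_two_smul_sub_map_two_smul_le_of_even heven (h.smul 2⁻¹)
  rw [smul_inv_smul₀ two_ne_zero, smul_inv_smul₀ two_ne_zero] at map_x_near_map_y
  rw [heven] at double_x
  calc ‖f ((2 : ℝ) • x) - (4 : ℝ) • f x‖
      = ‖(f ((2 : ℝ) • x) - (2 : ℝ) • f x - f y - f y) - ((f x - f y) + (f x - f y))‖ := by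
        congr 1
        module
    _ ≤ 3 * ε + (6 * ε + 6 * ε) :=
        norm_sub_le_of_le double_x (norm_add_le_of_le map_x_near_map_y map_x_near_map_y)
    _ = 15 * ε := by ring

lemma nearOrthAdditive_oddPart [NormedSpace ℝ Y] (hf : NearOrthAdditive ε f) :
    NearOrthAdditive ε (oddPart f) := fun x y h => by
  convert norm_inv_two_smul_sub_le (hf x y h) (hf (-x) (-y) (by simpa using h.smul (-1) (-1)))
    using 2
  simp only [oddPart, neg_add]
  module

lemma nearOrthAdditive_evenPart [NormedSpace ℝ Y] (hf : NearOrthAdditive ε f) :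
    NearOrthAdditive ε (evenPart f) := fun x y h => by
  convert norm_inv_two_smul_add_le (hf x y h) (hf (-x) (-y) (by simpa using h.smul (-1) (-1)))
    using 2
  simp only [evenPart, neg_add]
  module

/-! ### Exact orthogonal additivity -/

/-- Additivity on `ρ_*`-orthogonal pairs, the case `ε = 0` of `NearOrthAdditive`. -/
def OrthAdditive (F : X → Y) : Prop := ∀ x y : X, Orth x y → F (x + y) = F x + F y

lemma nearOrthAdditive_zero_iff : NearOrthAdditive 0 F ↔ OrthAdditive F := by
  simp only [NearOrthAdditive, OrthAdditive, norm_le_zero_iff, sub_sub, sub_eq_zero]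

lemma OrthAdditive.map_zero (hF : OrthAdditive F) : F 0 = 0 := by
  simpa using hF 0 0 (orth_zero_left 0)

lemma OrthAdditive.exists_thales_or_map_add (hX : 2 ≤ Module.rank ℝ X) (hF : OrthAdditive F)
    (x : X) {c : ℝ} (hc : 0 < c) :
    (∃ y, Thales c x y) ∨ ∀ a b : ℝ, F (a • x + b • x) = F (a • x) + F (b • x) := by
  refine ((nearOrthAdditive_zero_iff.2 hF).exists_thales_or_norm_cauchyDiff_le hX x hc).imp_right
    fun h a b => ?_
  have := h a b
  rwa [mul_zero, norm_le_zero_iff, cauchyDiff, hF.map_zero, add_zero, sub_sub,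
    sub_eq_zero] at this

lemma OrthAdditive.map_add_smul_of_thales (hF : OrthAdditive F) {c : ℝ} {x y : X}
    (h : Thales c x y) : F (x + c • x) = F x + F y + (F (c • x) + F (-y)) := by
  have diagonals := hF _ _ h.2
  have lower := hF _ _ (h.1.smul c (-1))
  rw [neg_one_smul] at lower
  rw [show x + y + (c • x - y) = x + c • x by abel, hF _ _ h.1, sub_eq_add_neg, lower]
    at diagonals
  exact diagonals

lemma OrthAdditive.map_sub_smul_of_thales (hF : OrthAdditive F) {c : ℝ} {x y : X}
    (h : Thales c x y) :
    F (x - c • x) + F ((2 : ℝ) • y) = F x + F y + (F (-(c • x)) + F y) := by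
  have diagonals := hF _ _ h.2.neg_right
  have upper := hF _ _ (h.1.smul_left (-c))
  have apart := hF _ _ (h.1.smul (1 - c) 2)
  rw [neg_smul] at upper
  rw [sub_smul, one_smul] at apart
  rw [show x + y + -(c • x - y) = x - c • x + (2 : ℝ) • y by module, hF _ _ h.1, apart,
    show -(c • x - y) = -(c • x) + y by abel, upper] at diagonals
  exact diagonals

lemma OrthAdditive.map_add_pos_smul_of_odd (hX : 2 ≤ Module.rank ℝ X) (hF : OrthAdditive F)
    (hodd : ∀ x, F (-x) = -F x) (x : X) {c : ℝ} (hc : 0 < c) :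
    F (x + c • x) = F x + F (c • x) := by
  rcases hF.exists_thales_or_map_add hX x hc with ⟨y, h⟩ | h
  · rw [hF.map_add_smul_of_thales h, hodd]
    abel
  · simpa using h 1 c

lemma OrthAdditive.map_sub_pos_smul_of_odd (hX : 2 ≤ Module.rank ℝ X) (hF : OrthAdditive F)
    (hodd : ∀ x, F (-x) = -F x) (x : X) {c : ℝ} (hc : 0 < c) :
    F (x - c • x) = F x - F (c • x) := by
  rcases hF.exists_thales_or_map_add hX x hc with ⟨y, h⟩ | h
  · have double_y := hF.map_add_pos_smul_of_odd hX hodd y one_pos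
    rw [one_smul, ← two_smul ℝ y] at double_y
    have := hF.map_sub_smul_of_thales h
    rw [double_y, hodd, ← eq_sub_iff_add_eq] at this
    rw [this]
    abel
  · simpa [sub_eq_add_neg, hodd] using h 1 (-c)

lemma OrthAdditive.isAdditive_of_odd (hX : 2 ≤ Module.rank ℝ X) (hF : OrthAdditive F)
    (hodd : ∀ x, F (-x) = -F x) : IsAdditive F := by
  have line (x : X) (β : ℝ) : F (x + β • x) = F x + F (β • x) := by
    rcases lt_trichotomy β 0 with hβ | rfl | hβ
    · simpa [hodd] using hF.map_sub_pos_smul_of_odd hX hodd x (neg_pos.2 hβ)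
    · simp [hF.map_zero]
    · exact hF.map_add_pos_smul_of_odd hX hodd x hβ
  intro x v
  obtain ⟨β, w, hxw, rfl⟩ := exists_eq_smul_add_orth x v
  have left := hF _ _ (hxw.smul_left (1 + β))
  rw [add_smul, one_smul] at left
  rw [← add_assoc, left, hF _ _ (hxw.smul_left β), line, add_assoc]

lemma map_smul_eq_zero_of_even_of_map_add [NormedSpace ℝ Y] (heven : ∀ x, F (-x) = F x) (x : X)
    (hadd : ∀ a b : ℝ, F (a • x + b • x) = F (a • x) + F (b • x)) (a : ℝ) : F (a • x) = 0 := by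
  have h0 : F 0 = 0 := by simpa using hadd 0 0
  have := hadd a (-a)
  rw [neg_smul, add_neg_cancel, h0, heven, ← two_smul ℝ] at this
  exact (smul_eq_zero.1 this.symm).resolve_left two_ne_zero

lemma OrthAdditive.map_two_smul_of_even [NormedSpace ℝ Y] (hX : 2 ≤ Module.rank ℝ X)
    (hF : OrthAdditive F) (heven : ∀ x, F (-x) = F x) (x : X) :
    F ((2 : ℝ) • x) = (4 : ℝ) • F x := by
  rcases hF.exists_thales_or_map_add hX x one_pos with ⟨y, h⟩ | h
  · have := (nearOrthAdditive_zero_iff.2 hF).norm_map_two_smul_sub_four_smul_le_of_even heven h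
    rwa [mul_zero, norm_le_zero_iff, sub_eq_zero] at this
  · have vanishes := map_smul_eq_zero_of_even_of_map_add heven x h
    rw [vanishes, ← one_smul ℝ x, vanishes, smul_zero]

lemma OrthAdditive.map_add_smul_add_map_sub_smul_of_even [NormedSpace ℝ Y]
    (hX : 2 ≤ Module.rank ℝ X) (hF : OrthAdditive F) (heven : ∀ x, F (-x) = F x) (x : X) {c : ℝ}
    (hc : 0 < c) : F (x + c • x) + F (x - c • x) = 2 • F x + 2 • F (c • x) := by
  rcases hF.exists_thales_or_map_add hX x hc with ⟨y, h⟩ | h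
  · have := hF.map_sub_smul_of_thales h
    rw [hF.map_two_smul_of_even hX heven, heven, ← eq_sub_iff_add_eq] at this
    rw [hF.map_add_smul_of_thales h, heven, this]
    module
  · have vanishes := map_smul_eq_zero_of_even_of_map_add heven x h
    have hx := vanishes 1
    have hadd := vanishes (1 + c)
    have hsub := vanishes (1 - c)
    rw [add_smul, one_smul] at hadd
    rw [sub_smul, one_smul] at hsub
    rw [one_smul] at hx
    rw [hadd, hsub, hx, vanishes]
    simp only [smul_zero, add_zero]

lemma OrthAdditive.isQuadratic_of_even [NormedSpace ℝ Y] (hX : 2 ≤ Module.rank ℝ X)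
    (hF : OrthAdditive F) (heven : ∀ x, F (-x) = F x) : IsQuadratic F := by
  have line (x : X) (β : ℝ) : F (x + β • x) + F (x - β • x) = 2 • F x + 2 • F (β • x) := by
    rcases lt_trichotomy β 0 with hβ | rfl | hβ
    · have := hF.map_add_smul_add_map_sub_smul_of_even hX heven x (neg_pos.2 hβ)
      rwa [neg_smul, heven, sub_neg_eq_add, ← sub_eq_add_neg, add_comm] at this
    · simp [hF.map_zero, two_smul]
    · exact hF.map_add_smul_add_map_sub_smul_of_even hX heven x hβ
  intro x v
  obtain ⟨β, w, hxw, rfl⟩ := exists_eq_smul_add_orth x v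
  have sum := hF _ _ (hxw.smul_left (1 + β))
  have difference := hF _ _ (hxw.smul (1 - β) (-1))
  rw [add_smul, one_smul] at sum
  rw [sub_smul, one_smul, neg_one_smul, heven] at difference
  rw [← add_assoc, sum, show x - (β • x + w) = x - β • x + -w by abel, difference,
    hF _ _ (hxw.smul_left β), add_add_add_comm, line]
  abel

end OrthogonalAdditivity

section Stability

/-! ### Limits of rescalings and stability -/

section HyersLimit

variable {X Y : Type*} [AddCommGroup X] [Module ℝ X] [NormedAddCommGroup Y] [NormedSpace ℝ Y]
  {g : X → Y} {x : X} {L : Y} {k C : ℝ}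

/-- `L` is the limit of Hyers' rescalings `k⁻ⁿ g(2ⁿ x)`. The factor `k = 2` extracts the additive
part of a mapping, the factor `k = 4` the quadratic part of an even one. -/
def IsHyersLimit (k : ℝ) (g : X → Y) (x : X) (L : Y) : Prop :=
  Tendsto (fun n : ℕ => (k ^ n)⁻¹ • g ((2 : ℝ) ^ n • x)) atTop (𝓝 L)

lemma exists_isHyersLimit [CompleteSpace Y] (hk : 1 < k)
    (h : ∀ n : ℕ, ‖g ((2 : ℝ) • (2 : ℝ) ^ n • x) - k • g ((2 : ℝ) ^ n • x)‖ ≤ C) :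
    ∃ L, IsHyersLimit k g x L ∧ ‖g x - L‖ ≤ C / (k - 1) := by
  have hk0 : 0 < k := one_pos.trans hk
  have hk1 : k⁻¹ < 1 := inv_lt_one_of_one_lt₀ hk
  have geometric (n : ℕ) : dist ((k ^ n)⁻¹ • g ((2 : ℝ) ^ n • x))
      ((k ^ (n + 1))⁻¹ • g ((2 : ℝ) ^ (n + 1) • x)) ≤ C / k * k⁻¹ ^ n := by
    have factor : (k ^ (n + 1))⁻¹ • g ((2 : ℝ) ^ (n + 1) • x) - (k ^ n)⁻¹ • g ((2 : ℝ) ^ n • x) =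
        (k ^ (n + 1))⁻¹ • (g ((2 : ℝ) • (2 : ℝ) ^ n • x) - k • g ((2 : ℝ) ^ n • x)) := by
      rw [smul_sub, smul_smul, smul_smul, ← pow_succ' (2 : ℝ), pow_succ k, mul_inv,
        inv_mul_cancel_right₀ hk0.ne']
    rw [dist_comm, dist_eq_norm, factor, norm_smul, Real.norm_of_nonneg (by positivity)]
    calc (k ^ (n + 1))⁻¹ * ‖g ((2 : ℝ) • (2 : ℝ) ^ n • x) - k • g ((2 : ℝ) ^ n • x)‖
        ≤ (k ^ (n + 1))⁻¹ * C := mul_le_mul_of_nonneg_left (h n) (by positivity)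
      _ = C / k * k⁻¹ ^ n := by rw [pow_succ, mul_inv, inv_pow]; ring
  obtain ⟨L, hL⟩ := cauchySeq_tendsto_of_complete (cauchySeq_of_le_geometric _ _ hk1 geometric)
  refine ⟨L, hL, ?_⟩
  have near := dist_le_of_le_geometric_of_tendsto₀ _ _ hk1 geometric hL
  rw [dist_eq_norm, pow_zero, inv_one, pow_zero, one_smul, one_smul] at near
  refine near.trans_eq ?_
  have : k - 1 ≠ 0 := by linarith
  field_simp

lemma tendsto_inv_pow_smul_of_norm_le (hk : 1 < k) {u : ℕ → Y} (h : ∀ n, ‖u n‖ ≤ C) :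
    Tendsto (fun n => (k ^ n)⁻¹ • u n) atTop (𝓝 0) :=
  (tendsto_inv_atTop_zero.comp (tendsto_pow_atTop_atTop_of_one_lt hk)).zero_smul_isBoundedUnder_le
    (isBoundedUnder_of ⟨C, h⟩)

lemma IsHyersLimit.neg_of_odd (hodd : ∀ x, g (-x) = -g x) (h : IsHyersLimit k g x L) :
    IsHyersLimit k g (-x) (-L) := by
  simpa only [IsHyersLimit, smul_neg, hodd] using Tendsto.neg h

lemma IsHyersLimit.neg_of_even (heven : ∀ x, g (-x) = g x) (h : IsHyersLimit k g x L) :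
    IsHyersLimit k g (-x) L := by
  simpa only [IsHyersLimit, smul_neg, heven] using h

end HyersLimit

variable {X Y : Type*} [NormedAddCommGroup X] [NormedSpace ℝ X] [NormedAddCommGroup Y]
  [NormedSpace ℝ Y] {f g F : X → Y} {ε k : ℝ}

lemma NearOrthAdditive.orthAdditive_of_isHyersLimit (hk : 1 < k) (hg : NearOrthAdditive ε g)
    (h : ∀ x, IsHyersLimit k g x (F x)) : OrthAdditive F := by
  intro x y hxy
  have error := tendsto_inv_pow_smul_of_norm_le hk fun n : ℕ =>
    hg _ _ (hxy.smul ((2 : ℝ) ^ n) ((2 : ℝ) ^ n))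
  have limit : Tendsto _ _ (𝓝 (F (x + y) - F x - F y)) := ((h (x + y)).sub (h x)).sub (h y)
  simp only [← smul_sub, smul_add] at limit
  rw [← sub_eq_zero, ← sub_sub]
  exact tendsto_nhds_unique limit error

variable [CompleteSpace Y]

lemma NearOrthAdditive.exists_isHyersLimit_of_thales (hf : NearOrthAdditive ε f) {x y : X}
    (h : Thales 1 x y) :
    ∃ L M : Y, IsHyersLimit 2 (oddPart f) x L ∧ IsHyersLimit 4 (evenPart f) x M ∧
      ‖f x - f 0 - L - M‖ ≤ 9 * ε := by
  obtain ⟨L, hL, hfL⟩ := exists_isHyersLimit (g := oddPart f) (x := x) one_lt_two fun n => by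
    simpa only [oddPart_neg, sub_neg_eq_add, sub_add_cancel] using
      (nearOrthAdditive_oddPart hf).norm_map_two_smul_sub_le (h.smul (2 ^ n))
  obtain ⟨M, hM, hfM⟩ := exists_isHyersLimit (g := evenPart f) (x := x) (k := 4) (by norm_num)
    fun n => (nearOrthAdditive_evenPart hf).norm_map_two_smul_sub_four_smul_le_of_even
      (evenPart_neg f) (h.smul (2 ^ n))
  refine ⟨L, M, hL, hM, ?_⟩
  calc ‖f x - f 0 - L - M‖ = ‖(oddPart f x - L) + (evenPart f x - M) - f 0‖ := by
        rw [← oddPart_add_evenPart f x]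
        congr 1
        abel
    _ ≤ 3 * ε / (2 - 1) + 15 * ε / (4 - 1) + ε :=
        norm_sub_le_of_le (norm_add_le_of_le hfL hfM) hf.norm_map_zero_le
    _ = 9 * ε := by ring

lemma exists_isHyersLimit_of_norm_cauchyDiff_le {C : ℝ} {x : X}
    (h : ∀ a b : ℝ, ‖cauchyDiff f (a • x) (b • x)‖ ≤ C) :
    ∃ L M : Y, IsHyersLimit 2 (oddPart f) x L ∧ IsHyersLimit 4 (evenPart f) x M ∧
      ‖f x - f 0 - L - M‖ ≤ C := by
  have even_near (n : ℕ) : ‖f 0 - evenPart f ((2 : ℝ) ^ n • x)‖ ≤ C / 2 :=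
    norm_map_zero_sub_evenPart_le (by simpa using h (2 ^ n) (-2 ^ n))
  have even_bounded (n : ℕ) : ‖evenPart f ((2 : ℝ) ^ n • x)‖ ≤ ‖f 0‖ + C / 2 := by
    simpa using norm_sub_le_of_le (le_refl ‖f 0‖) (even_near n)
  obtain ⟨L, hL, hfL⟩ := exists_isHyersLimit (g := fun y => f y - f 0) (x := x) one_lt_two
    fun n => by
      convert h (2 ^ n) (2 ^ n) using 2
      rw [cauchyDiff, ← two_smul ℝ]
      module
  have odd_near (n : ℕ) : ‖oddPart f ((2 : ℝ) ^ n • x) - (f ((2 : ℝ) ^ n • x) - f 0)‖ ≤ C / 2 := by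
    convert even_near n using 2
    rw [← oddPart_add_evenPart f (_ • x)]
    abel
  refine ⟨L, 0, ?_, tendsto_inv_pow_smul_of_norm_le (by norm_num) even_bounded, ?_⟩
  · simpa only [IsHyersLimit, ← smul_add, sub_add_cancel, zero_add] using
      (tendsto_inv_pow_smul_of_norm_le one_lt_two odd_near).add hL
  · refine (congrArg norm (sub_zero _)).trans_le (hfL.trans_eq ?_)
    ring

lemma NearOrthAdditive.exists_isHyersLimit (hX : 2 ≤ Module.rank ℝ X)
    (hf : NearOrthAdditive ε f) (x : X) :
    ∃ L M : Y, IsHyersLimit 2 (oddPart f) x L ∧ IsHyersLimit 4 (evenPart f) x M ∧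
      ‖f x - f 0 - L - M‖ ≤ 18 * ε := by
  rcases hf.exists_thales_or_norm_cauchyDiff_le hX x one_pos with ⟨y, h⟩ | h
  · obtain ⟨L, M, hL, hM, hLM⟩ := hf.exists_isHyersLimit_of_thales h
    exact ⟨L, M, hL, hM, hLM.trans (by linarith [hf.nonneg])⟩
  · exact exists_isHyersLimit_of_norm_cauchyDiff_le h

theorem NearOrthAdditive.exists_isAdditive_isQuadratic_norm_sub_le (hX : 2 ≤ Module.rank ℝ X)
    (hf : NearOrthAdditive ε f) :
    ∃ A Q : X → Y, IsAdditive A ∧ IsQuadratic Q ∧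
      ∀ x, ‖f x - f 0 - A x - Q x‖ ≤ 18 * ε := by
  choose A Q hA hQ hAQ using hf.exists_isHyersLimit hX
  have A_odd (x : X) : A (-x) = -A x :=
    tendsto_nhds_unique (hA (-x)) ((hA x).neg_of_odd (oddPart_neg f))
  have Q_even (x : X) : Q (-x) = Q x :=
    tendsto_nhds_unique (hQ (-x)) ((hQ x).neg_of_even (evenPart_neg f))
  have A_orth : OrthAdditive A :=
    (nearOrthAdditive_oddPart hf).orthAdditive_of_isHyersLimit one_lt_two hA
  have Q_orth : OrthAdditive Q :=
    (nearOrthAdditive_evenPart hf).orthAdditive_of_isHyersLimit (by norm_num) hQ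
  exact ⟨A, Q, A_orth.isAdditive_of_odd hX A_odd, Q_orth.isQuadratic_of_even hX Q_even, hAQ⟩

end Stability

end RhoStar

theorem mainTheorem9_general {X Y : Type*}
    [NormedAddCommGroup X] [NormedSpace ℝ X]
    [NormedAddCommGroup Y] [NormedSpace ℝ Y] [CompleteSpace Y]
    (hX : 2 ≤ Module.rank ℝ X)
    (f : X → Y) (ε : ℝ)
    (hf : ∀ x y : X, RhoStar.Orth x y → ‖f (x + y) - f x - f y‖ ≤ ε)
    {K : ℝ} (hK : 18 ≤ K) :
    ∃! AQ : (X → Y) × (X → Y),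
      RhoStar.IsAdditive AQ.1 ∧ RhoStar.IsQuadratic AQ.2 ∧
        ∀ x : X, ‖f x - f 0 - AQ.1 x - AQ.2 x‖ ≤ K * ε := by
  have near : RhoStar.NearOrthAdditive ε f := hf
  obtain ⟨A, Q, hA, hQ, hAQ⟩ := near.exists_isAdditive_isQuadratic_norm_sub_le hX
  refine ⟨(A, Q), ⟨hA, hQ, fun x => ?_⟩, ?_⟩
  · exact (hAQ x).trans (mul_le_mul_of_nonneg_right hK near.nonneg)
  · rintro ⟨A', Q'⟩ ⟨hA', hQ', hAQ'⟩
    exact Prod.ext_iff.2 (RhoStar.additive_quadratic_unique hA' hA hQ' hQ hAQ' hAQ)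

theorem mainTheorem9 {X Y : Type*}
    [NormedAddCommGroup X] [NormedSpace ℝ X]
    [NormedAddCommGroup Y] [NormedSpace ℝ Y] [CompleteSpace Y]
    (hX : 2 ≤ Module.rank ℝ X)
    (f : X → Y) (ε : ℝ)
    (hf : ∀ x y : X, RhoStar.Orth x y → ‖f (x + y) - f x - f y‖ ≤ ε) :
    ∃! AQ : (X → Y) × (X → Y),
      RhoStar.IsAdditive AQ.1 ∧ RhoStar.IsQuadratic AQ.2 ∧
        ∀ x : X, ‖f x - f 0 - AQ.1 x - AQ.2 x‖ ≤ 68 / 3 * ε :=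
  mainTheorem9_general hX f ε hf (by norm_num)
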